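/- Let $K_{1,3}$ be the star with one center and three leaves, let $P_n$ be the path on $n$ vertices, and let $K_{1,3}\times P_n$ be their Cartesian product, a graph with $4n$ vertices: two vertices $(v_1,v_2)$ and $(w_1,w_2)$ are adjacent if and only if either $v_1=w_1$ and $v_2w_2$ is an edge of $P_n$, or $v_2=w_2$ and $v_1w_1$ is an edge of $K_{1,3}$. A $2$-colored partition of a graph $G$ is a coloring of its vertices with two colors together with a partition of its vertex set into blocks such that every block induces a connected subgraph, all vertices of a block have the same color, and any two blocks joined by an edge have different colors. Each coloring of the vertices underlies exactly one such partition. Let $X(G)$ be the number of blocks of the $2$-colored partition of $G$ obtained by coloring each vertex uniformly and independently with one of two colors; equivalently, $X(G)$ is the number of blocks of a uniformly random $2$-colored partition of $G$. Then for every integer $n\ge 1$, $$\mathbb{E}\left[X(K_{1,3}\times P_n)\right]=\frac{2254219}{1411200}+\frac{6}{49}\,2^{-3n}-\frac{2}{225}\,2^{-4n}+\frac{11933}{13440}\,n.$$ -/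

import Mathlib

open MeasureTheory ProbabilityTheory SimpleGraph

namespace BlockColoring

universe u

variable {V : Type u}

/-- Two non-empty disjoint vertex sets are neighbors if some edge joins them. -/
def Neighbors (G : SimpleGraph V) (A B : Set V) : Prop :=
  A.Nonempty ∧ B.Nonempty ∧ Disjoint A B ∧ ∃ a ∈ A, ∃ b ∈ B, G.Adj a b

/-- A `k`-colored partition of the vertices of `G`: a coloring of the vertices with `k` colors and
a partition of the vertex set into blocks, each of which induces a connected subgraph and is
monochromatic, and such that neighboring blocks have different colors. -/
@[ext]
structure ColoredPartition (G : SimpleGraph V) (k : ℕ) where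
  color : V → Fin k
  blocks : Set (Set V)
  isPartition : Setoid.IsPartition blocks
  connected : ∀ B ∈ blocks, (G.induce B).Connected
  monochromatic : ∀ B ∈ blocks, ∀ v ∈ B, ∀ w ∈ B, color v = color w
  neighbors_color_ne : ∀ A ∈ blocks, ∀ B ∈ blocks, Neighbors G A B →
    ∀ v ∈ A, ∀ w ∈ B, color v ≠ color w

/-- The size of a colored partition: its number of blocks. -/
noncomputable def ColoredPartition.size {G : SimpleGraph V} {k : ℕ}
    (T : ColoredPartition G k) : ℕ :=
  T.blocks.ncard

/-- Auxiliary: the edges of `G` whose endpoints have the same color. -/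
def monoGraph (G : SimpleGraph V) {k : ℕ} (c : V → Fin k) : SimpleGraph V where
  Adj v w := G.Adj v w ∧ c v = c w
  symm := ⟨fun _ _ h => ⟨h.1.symm, h.2.symm⟩⟩
  loopless := ⟨fun v h => G.loopless.irrefl v h.1⟩

theorem monoGraph_reachable_color {G : SimpleGraph V} {k : ℕ} {c : V → Fin k} {v w : V}
    (h : (monoGraph G c).Reachable v w) : c v = c w := by
  obtain ⟨p⟩ := h
  induction p with
  | nil => rfl
  | cons h _ ih => exact h.2.trans ih

theorem ColoredPartition.block_eq {G : SimpleGraph V} {k : ℕ} (T : ColoredPartition G k)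
    {B : Set V} (hB : B ∈ T.blocks) {v : V} (hv : v ∈ B) :
    B = {w | (monoGraph G T.color).Reachable v w} := by
  ext w
  constructor
  · intro hw
    let f : G.induce B →g monoGraph G T.color :=
      ⟨Subtype.val, fun {a b} hab => ⟨hab, T.monochromatic B hB a a.2 b b.2⟩⟩
    exact ((T.connected B hB).preconnected ⟨v, hv⟩ ⟨w, hw⟩).map f
  · rintro ⟨p⟩
    induction p with
    | nil => exact hv
    | @cons a b _ h _ ih =>
      apply ih
      by_contra hb
      obtain ⟨B', ⟨hB', hb'⟩, -⟩ := T.isPartition.2 b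
      have hd : Disjoint B B' := by
        rw [Set.disjoint_left]
        intro x hx hx'
        have := (T.isPartition.2 x).unique ⟨hB, hx⟩ ⟨hB', hx'⟩
        exact hb (this ▸ hb')
      exact T.neighbors_color_ne B hB B' hB' ⟨⟨a, hv⟩, ⟨b, hb'⟩, hd, a, hv, b, hb', h.1⟩
        a hv b hb' h.2

/-- Every coloring of the vertices underlies exactly one colored partition. -/
theorem existsUnique_coloredPartition (G : SimpleGraph V) {k : ℕ} (c : V → Fin k) :
    ∃! T : ColoredPartition G k, T.color = c := by
  refine ⟨⟨c, {B | ∃ v, B = {w | (monoGraph G c).Reachable v w}}, ⟨?_, ?_⟩, ?_, ?_, ?_⟩, rfl, ?_⟩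
  · rintro ⟨v, hv⟩
    have : v ∈ (∅ : Set V) := by rw [hv]; exact Reachable.refl v
    exact this
  · intro v
    refine ⟨{w | (monoGraph G c).Reachable v w}, ⟨⟨v, rfl⟩, Reachable.refl v⟩, ?_⟩
    rintro _ ⟨⟨u, rfl⟩, hu⟩
    ext w
    exact ⟨fun h => Reachable.trans (Reachable.symm hu) h, fun h => Reachable.trans hu h⟩
  · rintro _ ⟨v, rfl⟩
    have key : ∀ (a b : V) (p : (monoGraph G c).Walk a b)
        (ha : (monoGraph G c).Reachable v a) (hb : (monoGraph G c).Reachable v b),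
        (G.induce {w | (monoGraph G c).Reachable v w}).Reachable ⟨a, ha⟩ ⟨b, hb⟩ := by
      intro a b p
      induction p with
      | nil => intro _ _; exact Reachable.refl _
      | @cons a b _ h _ ih =>
        intro ha hb
        have hm : (monoGraph G c).Reachable v b := ha.trans h.reachable
        have h1 : (G.induce {w | (monoGraph G c).Reachable v w}).Adj ⟨a, ha⟩ ⟨b, hm⟩ := h.1
        exact h1.reachable.trans (ih hm hb)
    have : Nonempty {w | (monoGraph G c).Reachable v w} := ⟨⟨v, Reachable.refl v⟩⟩
    refine ⟨fun a b => ?_⟩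
    obtain ⟨p⟩ := (Reachable.symm a.2).trans b.2
    exact key _ _ p a.2 b.2
  · rintro _ ⟨u, rfl⟩ v hv w hw
    exact (monoGraph_reachable_color hv).symm.trans (monoGraph_reachable_color hw)
  · rintro _ ⟨u, rfl⟩ _ ⟨u', rfl⟩ ⟨-, -, hd, a, ha, b, hb, hab⟩ v hv w hw hvw
    have h1 : c a = c b := by
      rw [← monoGraph_reachable_color ha, ← monoGraph_reachable_color hb,
        monoGraph_reachable_color hv, monoGraph_reachable_color hw, hvw]
    have h2 : (monoGraph G c).Adj a b := ⟨hab, h1⟩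
    exact Set.disjoint_left.1 hd (Reachable.trans ha h2.reachable) hb
  · rintro T rfl
    refine ColoredPartition.ext rfl ?_
    ext B
    constructor
    · intro hB
      obtain ⟨v, hv⟩ : B.Nonempty := by
        rw [Set.nonempty_iff_ne_empty]
        rintro rfl
        exact T.isPartition.1 hB
      exact ⟨v, T.block_eq hB hv⟩
    · rintro ⟨v, rfl⟩
      obtain ⟨B, ⟨hB, hv⟩, -⟩ := T.isPartition.2 v
      rw [← T.block_eq hB hv]
      exact hB

/-- The unique colored partition with a given underlying coloring. -/
noncomputable def partitionOfColoring (G : SimpleGraph V) {k : ℕ} (c : V → Fin k) :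
    ColoredPartition G k :=
  (existsUnique_coloredPartition G c).choose

theorem partitionOfColoring_color (G : SimpleGraph V) {k : ℕ} (c : V → Fin k) :
    (partitionOfColoring G c).color = c :=
  (existsUnique_coloredPartition G c).choose_spec.1

/-- The law of a random coloring in which the vertices receive independent uniform colors. -/
noncomputable def coloringLaw (V : Type u) [Fintype V] (k : ℕ) : Measure (V → Fin k) :=
  Measure.pi fun _ => uniformOn (Set.univ : Set (Fin k))

/-- The set of colored partitions carries the discrete sigma-algebra. -/
instance (G : SimpleGraph V) (k : ℕ) : MeasurableSpace (ColoredPartition G k) := ⊤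

/-- The product of the star `K_{1,3}` with the path on `n` vertices. -/
abbrev starPath (n : ℕ) : SimpleGraph ((Fin 1 ⊕ Fin 3) × Fin n) :=
  completeBipartiteGraph (Fin 1) (Fin 3) □ pathGraph n

end BlockColoring

namespace BlockColoring

/-! Blocks are the components of the graph of monochromatic edges, and they are counted by a
transfer argument: put a new star layer `y` in front of a coloring `c` and see how the count
changes. A new leaf whose color differs from the new center's is either isolated or hangs on the
single block behind it, so merging happens only through the new center. This gives `size_consLayer`:
the count grows by one for the center's block and by the number of isolated leaves, and drops by the
number of old blocks that the center's block absorbs.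

If the two centers agree in color, exactly one block is absorbed. Otherwise the absorbed blocks are
reached through leaves, and inclusion-exclusion (`ncard_touched`) requires knowing which leaves of
the old first layer are already joined away from their center. Hence the auxiliary totals
`pairTotal` and `tripleTotal`, which obey closed linear recurrences by `reachable_consLayer_leaves`.
Together with `blockTotal_succ` they form a triangular system with eigenvalues 16, 2 and 1. After
division by `16 ^ n`, the resonance at 16 gives the term linear in `n`, and the other two give
`2^(-3n)` and `2^(-4n)`. -/

/-! ### Counting blocks through a labeling whose fibers are the blocks. -/

theorem size_partitionOfColoring_eq_ncard_range {V : Type*} (G : SimpleGraph V) {k : ℕ}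
    (c : V → Fin k) {L : Type*} (f : V → L)
    (hf : ∀ u v, (monoGraph G c).Reachable u v ↔ f u = f v) :
    (partitionOfColoring G c).size = (Set.range f).ncard := by
  have hb : (partitionOfColoring G c).blocks = (fun l => f ⁻¹' {l}) '' Set.range f := by
    have hc := partitionOfColoring_color G c
    set T := partitionOfColoring G c
    have key : ∀ v, {w | (monoGraph G T.color).Reachable v w} = f ⁻¹' {f v} := by
      intro v
      ext w
      simp only [hc, Set.mem_ofPred_eq, hf, Set.mem_preimage, Set.mem_singleton_iff]
      exact eq_comm
    ext B
    constructor
    · intro hB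
      obtain ⟨⟨v, hv⟩⟩ := (T.connected B hB).nonempty
      exact ⟨f v, ⟨v, rfl⟩, by rw [T.block_eq hB hv, key]⟩
    · rintro ⟨_, ⟨v, rfl⟩, rfl⟩
      obtain ⟨B, ⟨hB, hv⟩, -⟩ := T.isPartition.2 v
      have := T.block_eq hB hv
      rw [key] at this
      change f ⁻¹' {f v} ∈ T.blocks
      rwa [← this]
  rw [ColoredPartition.size, hb, Set.InjOn.ncard_image]
  rintro _ ⟨v, rfl⟩ _ ⟨w, rfl⟩ h
  have : v ∈ f ⁻¹' {f w} := by
    have h' : f ⁻¹' {f v} = f ⁻¹' {f w} := h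
    rw [← h']; rfl
  exact this

theorem size_partitionOfColoring_eq_card {V : Type*} (G : SimpleGraph V) {k : ℕ}
    (c : V → Fin k) :
    (partitionOfColoring G c).size = Nat.card (monoGraph G c).ConnectedComponent := by
  rw [size_partitionOfColoring_eq_ncard_range G c (monoGraph G c).connectedComponentMk
    (fun u v => ConnectedComponent.eq.symm), Set.range_eq_univ.2, Set.ncard_univ]
  exact Quot.mk_surjective

/-! ### Splitting off the first layer. -/

/-- Put a new first layer in front of a coloring of `n` layers. -/
def consLayer {α β : Type*} {n : ℕ} (y : α → β) (c : α × Fin n → β) : α × Fin (n + 1) → β :=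
  fun p => Fin.cons (α := fun _ => β) (y p.1) (fun k => c (p.1, k)) p.2

@[simp] theorem consLayer_zero {α β : Type*} {n : ℕ} (y : α → β) (c : α × Fin n → β) (v : α) :
    consLayer y c (v, 0) = y v := rfl

@[simp] theorem consLayer_succ {α β : Type*} {n : ℕ} (y : α → β) (c : α × Fin n → β) (v : α)
    (k : Fin n) : consLayer y c (v, k.succ) = c (v, k) := rfl

/-- A coloring of `n + 1` layers is a coloring of the first one and of the other `n`. -/
def consLayerEquiv (α β : Type*) (n : ℕ) :
    (α → β) × (α × Fin n → β) ≃ (α × Fin (n + 1) → β) where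
  toFun p := consLayer p.1 p.2
  invFun c := (fun v => c (v, 0), fun p => c (p.1, p.2.succ))
  left_inv _ := rfl
  right_inv c := by
    ext ⟨v, k⟩
    refine Fin.cases ?_ (fun k => ?_) k <;> rfl

theorem sum_consLayer {α β M : Type*} [Fintype α] [DecidableEq α] [Fintype β] [AddCommMonoid M]
    {n : ℕ} (F : (α × Fin (n + 1) → β) → M) :
    ∑ c, F c = ∑ c : α × Fin n → β, ∑ y : α → β, F (consLayer y c) := by
  rw [← (consLayerEquiv α β n).sum_comp, Fintype.sum_prod_type_right]
  rfl

/-! ### How the blocks change when a layer is added. -/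

section

variable {n : ℕ} (y : Fin 1 ⊕ Fin 3 → Fin 2) (c : (Fin 1 ⊕ Fin 3) × Fin (n + 1) → Fin 2)

/-- The blocks in the old layers that the block of the new center meets. -/
def Touched (a : (monoGraph (starPath (n + 1)) c).ConnectedComponent) : Prop :=
  ∃ v, c (v, 0) = y v ∧ y v = y (.inl 0) ∧ connectedComponentMk _ (v, 0) = a

open Classical in
/-- The name, in the extended graph, of a block of the old layers. -/
noncomputable def oldLabel (a : (monoGraph (starPath (n + 1)) c).ConnectedComponent) :
    Option ((Fin 1 ⊕ Fin 3) ⊕ (monoGraph (starPath (n + 1)) c).ConnectedComponent) :=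
  if Touched y c a then none else some (.inr a)

open Classical in
/-- A function whose fibers are the blocks after adding a layer: `none` is the block of the new
center, the other values are isolated new leaves and blocks of the old layers. -/
noncomputable def blockLabel (p : (Fin 1 ⊕ Fin 3) × Fin (n + 2)) :
    Option ((Fin 1 ⊕ Fin 3) ⊕ (monoGraph (starPath (n + 1)) c).ConnectedComponent) :=
  Fin.cases (motive := fun _ => _)
    (if y p.1 = y (.inl 0) then none
      else if c (p.1, 0) = y p.1 then oldLabel y c (connectedComponentMk _ (p.1, 0))
      else some (.inl p.1))
    (fun k => oldLabel y c (connectedComponentMk _ (p.1, k))) p.2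

open Classical in
theorem blockLabel_zero (v : Fin 1 ⊕ Fin 3) :
    blockLabel y c (v, 0) = if y v = y (.inl 0) then none
      else if c (v, 0) = y v then oldLabel y c (connectedComponentMk _ (v, 0))
      else some (.inl v) := rfl

theorem blockLabel_succ (v : Fin 1 ⊕ Fin 3) (k : Fin (n + 1)) :
    blockLabel y c (v, k.succ) = oldLabel y c (connectedComponentMk _ (v, k)) := rfl

theorem monoGraph_consLayer_adj_zero_zero (v w : Fin 1 ⊕ Fin 3) :
    (monoGraph (starPath (n + 2)) (consLayer y c)).Adj (v, 0) (w, 0) ↔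
      (completeBipartiteGraph (Fin 1) (Fin 3)).Adj v w ∧ y v = y w := by
  simp [monoGraph, boxProd_adj]

theorem monoGraph_consLayer_adj_zero_succ (v w : Fin 1 ⊕ Fin 3) (l : Fin (n + 1)) :
    (monoGraph (starPath (n + 2)) (consLayer y c)).Adj (v, 0) (w, l.succ) ↔
      v = w ∧ l = 0 ∧ c (v, 0) = y v := by
  simp only [monoGraph, boxProd_adj, pathGraph_adj, consLayer_zero, consLayer_succ]
  constructor
  · rintro ⟨⟨_, h⟩ | ⟨h, rfl⟩, h'⟩
    · exact absurd h.symm (Fin.succ_ne_zero l)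
    · have : l = 0 := by
        ext
        simpa using h
      subst this
      exact ⟨rfl, rfl, h'.symm⟩
  · rintro ⟨rfl, rfl, h⟩
    exact ⟨Or.inr ⟨by simp, rfl⟩, h.symm⟩

theorem monoGraph_consLayer_adj_succ_succ (v w : Fin 1 ⊕ Fin 3) (k l : Fin (n + 1)) :
    (monoGraph (starPath (n + 2)) (consLayer y c)).Adj (v, k.succ) (w, l.succ) ↔
      (monoGraph (starPath (n + 1)) c).Adj (v, k) (w, l) := by
  simp [monoGraph, boxProd_adj, pathGraph_adj]

theorem eq_center_of_adj {v w : Fin 1 ⊕ Fin 3}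
    (h : (completeBipartiteGraph (Fin 1) (Fin 3)).Adj v w) : v = .inl 0 ∨ w = .inl 0 := by
  rcases v with v | v <;> rcases w with w | w <;> simp_all [Fin.fin_one_eq_zero]

theorem blockLabel_eq_of_adj_zero_succ {v w : Fin 1 ⊕ Fin 3} {l : Fin (n + 1)}
    (h : (monoGraph (starPath (n + 2)) (consLayer y c)).Adj (v, 0) (w, l.succ)) :
    blockLabel y c (v, 0) = blockLabel y c (w, l.succ) := by
  obtain ⟨rfl, rfl, hc⟩ := (monoGraph_consLayer_adj_zero_succ y c v w l).1 h
  rw [blockLabel_zero, blockLabel_succ]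
  split_ifs with h1
  · rw [oldLabel, if_pos ⟨v, hc, h1, rfl⟩]
  · rfl

theorem blockLabel_eq_of_adj {p q : (Fin 1 ⊕ Fin 3) × Fin (n + 2)}
    (h : (monoGraph (starPath (n + 2)) (consLayer y c)).Adj p q) :
    blockLabel y c p = blockLabel y c q := by
  obtain ⟨v, k⟩ := p
  obtain ⟨w, l⟩ := q
  induction k using Fin.cases with
  | zero =>
    induction l using Fin.cases with
    | zero =>
      obtain ⟨h, h'⟩ := (monoGraph_consLayer_adj_zero_zero y c v w).1 h
      rcases eq_center_of_adj h with rfl | rfl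
      · rw [blockLabel_zero, blockLabel_zero, if_pos rfl, if_pos h'.symm]
      · rw [blockLabel_zero, blockLabel_zero, if_pos rfl, if_pos h']
    | succ l => exact blockLabel_eq_of_adj_zero_succ y c h
  | succ k =>
    induction l using Fin.cases with
    | zero => exact (blockLabel_eq_of_adj_zero_succ y c h.symm).symm
    | succ l =>
      rw [monoGraph_consLayer_adj_succ_succ] at h
      rw [blockLabel_succ, blockLabel_succ, ConnectedComponent.eq.2 h.reachable]

theorem reachable_consLayer_succ {v w : Fin 1 ⊕ Fin 3} {k l : Fin (n + 1)}
    (h : (monoGraph (starPath (n + 1)) c).Reachable (v, k) (w, l)) :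
    (monoGraph (starPath (n + 2)) (consLayer y c)).Reachable (v, k.succ) (w, l.succ) := by
  let f : monoGraph (starPath (n + 1)) c →g monoGraph (starPath (n + 2)) (consLayer y c) :=
    ⟨fun p => (p.1, p.2.succ), fun {a b} h =>
      (monoGraph_consLayer_adj_succ_succ y c a.1 b.1 a.2 b.2).2 h⟩
  exact h.map f

theorem reachable_consLayer_center {v : Fin 1 ⊕ Fin 3} (h : y v = y (.inl 0)) :
    (monoGraph (starPath (n + 2)) (consLayer y c)).Reachable (v, 0) (.inl 0, 0) := by
  rcases v with v | v
  · rw [Fin.fin_one_eq_zero v]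
  · exact Adj.reachable ((monoGraph_consLayer_adj_zero_zero y c _ _).2 ⟨by simp, h⟩)

theorem reachable_consLayer_down {v : Fin 1 ⊕ Fin 3} (h : c (v, 0) = y v) :
    (monoGraph (starPath (n + 2)) (consLayer y c)).Reachable (v, 0) (v, Fin.succ 0) :=
  Adj.reachable ((monoGraph_consLayer_adj_zero_succ y c v v 0).2 ⟨rfl, rfl, h⟩)

theorem reachable_of_oldLabel_eq_none {v : Fin 1 ⊕ Fin 3} {k : Fin (n + 1)}
    (h : oldLabel y c (connectedComponentMk _ (v, k)) = none) :
    (monoGraph (starPath (n + 2)) (consLayer y c)).Reachable (v, k.succ) (.inl 0, 0) := by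
  rw [oldLabel] at h
  split_ifs at h with ht
  obtain ⟨w, hw, hw', he⟩ := ht
  exact (reachable_consLayer_succ y c (ConnectedComponent.eq.1 he.symm)).trans
    ((reachable_consLayer_down y c hw).symm.trans (reachable_consLayer_center y c hw'))

theorem reachable_of_blockLabel_eq_none {p : (Fin 1 ⊕ Fin 3) × Fin (n + 2)}
    (h : blockLabel y c p = none) :
    (monoGraph (starPath (n + 2)) (consLayer y c)).Reachable p (.inl 0, 0) := by
  obtain ⟨v, k⟩ := p
  induction k using Fin.cases with
  | zero =>
    rw [blockLabel_zero] at h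
    split_ifs at h with h1 h2
    · exact reachable_consLayer_center y c h1
    · exact (reachable_consLayer_down y c h2).trans (reachable_of_oldLabel_eq_none y c h)
  | succ k => exact reachable_of_oldLabel_eq_none y c h

theorem oldLabel_ne_inl (a) (v : Fin 1 ⊕ Fin 3) : oldLabel y c a ≠ some (.inl v) := by
  rw [oldLabel]
  split_ifs <;> simp

theorem eq_of_oldLabel_eq_inr {a b} (h : oldLabel y c a = some (.inr b)) : a = b := by
  rw [oldLabel] at h
  split_ifs at h
  simpa using h

theorem eq_of_blockLabel_eq_inl {p : (Fin 1 ⊕ Fin 3) × Fin (n + 2)} {v : Fin 1 ⊕ Fin 3}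
    (h : blockLabel y c p = some (.inl v)) : p = (v, 0) := by
  obtain ⟨w, k⟩ := p
  induction k using Fin.cases with
  | zero =>
    rw [blockLabel_zero] at h
    split_ifs at h with h1 h2
    · exact absurd h (oldLabel_ne_inl y c _ _)
    · simp only [Option.some.injEq, Sum.inl.injEq] at h
      rw [h]
  | succ k => exact absurd h (oldLabel_ne_inl y c _ _)

theorem reachable_of_blockLabel_eq_inr {p : (Fin 1 ⊕ Fin 3) × Fin (n + 2)}
    {w : Fin 1 ⊕ Fin 3} {l : Fin (n + 1)}
    (h : blockLabel y c p = some (.inr (connectedComponentMk _ (w, l)))) :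
    (monoGraph (starPath (n + 2)) (consLayer y c)).Reachable p (w, l.succ) := by
  obtain ⟨v, k⟩ := p
  induction k using Fin.cases with
  | zero =>
    rw [blockLabel_zero] at h
    split_ifs at h with h1 h2
    · exact (reachable_consLayer_down y c h2).trans
        (reachable_consLayer_succ y c (ConnectedComponent.eq.1 (eq_of_oldLabel_eq_inr y c h)))
    · simp at h
  | succ k =>
    exact reachable_consLayer_succ y c (ConnectedComponent.eq.1 (eq_of_oldLabel_eq_inr y c h))

/-- The label is constant along monochromatic edges. Conversely, each label value singles out a base
vertex (the new center, an isolated leaf, or a vertex of an old block) that every vertex with that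
label reaches. -/
theorem reachable_consLayer_iff (p q : (Fin 1 ⊕ Fin 3) × Fin (n + 2)) :
    (monoGraph (starPath (n + 2)) (consLayer y c)).Reachable p q ↔
      blockLabel y c p = blockLabel y c q := by
  constructor
  · rintro ⟨w⟩
    induction w with
    | nil => rfl
    | cons h _ ih => exact (blockLabel_eq_of_adj y c h).trans ih
  · intro h
    rcases hq : blockLabel y c q with _ | v | a
    · rw [hq] at h
      exact (reachable_of_blockLabel_eq_none y c h).trans
        (reachable_of_blockLabel_eq_none y c hq).symm
    · rw [hq] at h
      rw [eq_of_blockLabel_eq_inl y c h, eq_of_blockLabel_eq_inl y c hq]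
    · induction a using ConnectedComponent.ind with | h a =>
      rw [hq] at h
      exact (reachable_of_blockLabel_eq_inr y c h).trans
        (reachable_of_blockLabel_eq_inr y c hq).symm

/-- Absorbed blocks carry the color of the new center, so a block of the other color keeps its own
name. -/
theorem oldLabel_of_ne {v : Fin 1 ⊕ Fin 3} {k : Fin (n + 1)} (h : c (v, k) ≠ y (.inl 0)) :
    oldLabel y c (connectedComponentMk _ (v, k)) =
      some (.inr (connectedComponentMk _ (v, k))) := by
  rw [oldLabel, if_neg]
  rintro ⟨w, hw, hw', he⟩
  exact h (by rw [← monoGraph_reachable_color (ConnectedComponent.eq.1 he), hw, hw'])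

theorem range_blockLabel :
    Set.range (blockLabel y c) = {none} ∪
      ((fun v => some (.inl v)) '' {v | y v ≠ y (.inl 0) ∧ c (v, 0) ≠ y v} ∪
        (fun a => some (.inr a)) '' {a | ¬ Touched y c a}) := by
  ext l
  constructor
  · rintro ⟨p, rfl⟩
    have hold : ∀ a, oldLabel y c a ∈ ({none} ∪
      ((fun v => some (.inl v)) '' {v | y v ≠ y (.inl 0) ∧ c (v, 0) ≠ y v} ∪
        (fun a => some (.inr a)) '' {a | ¬ Touched y c a}) : Set _) := by
      intro a
      rw [oldLabel]
      split_ifs with h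
      · simp
      · exact Or.inr (Or.inr ⟨a, h, rfl⟩)
    obtain ⟨v, k⟩ := p
    induction k using Fin.cases with
    | zero =>
      rw [blockLabel_zero]
      split_ifs with h1 h2
      · simp
      · exact hold _
      · exact Or.inr (Or.inl ⟨v, ⟨h1, h2⟩, rfl⟩)
    | succ k => exact hold _
  · rintro (rfl | ⟨v, ⟨h1, h2⟩, rfl⟩ | ⟨a, ha, rfl⟩)
    · exact ⟨(.inl 0, 0), by rw [blockLabel_zero, if_pos rfl]⟩
    · exact ⟨(v, 0), by rw [blockLabel_zero, if_neg h1, if_neg h2]⟩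
    · induction a using ConnectedComponent.ind with | h a =>
      exact ⟨(a.1, a.2.succ), by rw [blockLabel_succ, oldLabel, if_neg ha]⟩

/-- Count the labels in `range_blockLabel`: the center's block, the isolated leaves, and the old
blocks that are not absorbed. -/
theorem size_consLayer :
    (partitionOfColoring (starPath (n + 2)) (consLayer y c)).size
        + {a | Touched y c a}.ncard
      = (partitionOfColoring (starPath (n + 1)) c).size + 1
        + {v | y v ≠ y (.inl 0) ∧ c (v, 0) ≠ y v}.ncard := by
  rw [size_partitionOfColoring_eq_ncard_range _ _ _ (reachable_consLayer_iff y c),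
    size_partitionOfColoring_eq_card, range_blockLabel, Set.ncard_union_eq,
    Set.ncard_union_eq, Set.ncard_singleton, Set.ncard_image_of_injective,
    Set.ncard_image_of_injective, ← Set.ncard_add_ncard_compl {a | Touched y c a}]
  · rw [Set.compl_ofPred]; ring
  · intro a b h; simpa using h
  · intro a b h; simpa using h
  · rw [Set.disjoint_left]
    rintro _ ⟨v, -, rfl⟩ ⟨a, -, h⟩
    simp at h
  · simp

/-- A leaf not colored like the new center has only the vertex behind it as a possible neighbor in
its block. Two such leaves are therefore joined exactly when both continue backwards and their old
blocks coincide, which is what closes the recurrences. -/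
theorem reachable_consLayer_leaves {i j : Fin 3} (hij : i ≠ j) :
    (y (.inr i) ≠ y (.inl 0) ∧
      (monoGraph (starPath (n + 2)) (consLayer y c)).Reachable (.inr i, 0) (.inr j, 0)) ↔
    y (.inr i) ≠ y (.inl 0) ∧ y (.inr i) = c (.inr i, 0) ∧ y (.inr j) = c (.inr j, 0) ∧
      (monoGraph (starPath (n + 1)) c).Reachable (.inr i, 0) (.inr j, 0) := by
  refine and_congr_right fun hi => ?_
  constructor
  · intro h
    have hc : y (.inr i) = y (.inr j) := by simpa using monoGraph_reachable_color h
    have hj : y (.inr j) ≠ y (.inl 0) := hc ▸ hi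
    rw [reachable_consLayer_iff, blockLabel_zero, blockLabel_zero, if_neg hi, if_neg hj] at h
    split_ifs at h with h1 h2 h2
    · rw [oldLabel_of_ne y c (h1 ▸ hi), oldLabel_of_ne y c (h2 ▸ hj)] at h
      simp only [Option.some.injEq, Sum.inr.injEq] at h
      exact ⟨h1.symm, h2.symm, ConnectedComponent.eq.1 h⟩
    · exact absurd h (oldLabel_ne_inl y c _ _)
    · exact absurd h.symm (oldLabel_ne_inl y c _ _)
    · simp [hij] at h
  · rintro ⟨h1, h2, h⟩
    exact (reachable_consLayer_down y c h1.symm).trans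
      ((reachable_consLayer_succ y c h).trans (reachable_consLayer_down y c h2.symm).symm)

end

/-! ### Inclusion-exclusion and finite sums over the colorings of one layer. -/

open Classical in
theorem ncard_image_fin_three {A : Type*} (ρ : Fin 3 → A) (p : Fin 3 → Prop)
    [DecidablePred p] :
    ((ρ '' {i | p i}).ncard : ℤ)
      = (if p 0 then 1 else 0) + (if p 1 then 1 else 0) + (if p 2 then 1 else 0)
        - (if p 0 ∧ p 1 ∧ ρ 0 = ρ 1 then 1 else 0) - (if p 0 ∧ p 2 ∧ ρ 0 = ρ 2 then 1 else 0)
        - (if p 1 ∧ p 2 ∧ ρ 1 = ρ 2 then 1 else 0)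
        + (if p 0 ∧ p 1 ∧ p 2 ∧ ρ 0 = ρ 1 ∧ ρ 0 = ρ 2 then 1 else 0) := by
  have h : ρ '' {i | p i} = ((Finset.univ.filter p).image ρ : Finset A) := by ext; simp
  have hu : (Finset.univ : Finset (Fin 3)) = {0, 1, 2} := rfl
  rw [h, Set.ncard_coe_finset, hu]
  by_cases h0 : p 0 <;> by_cases h1 : p 1 <;> by_cases h2 : p 2 <;>
  by_cases e1 : ρ 0 = ρ 1 <;> by_cases e2 : ρ 0 = ρ 2 <;> by_cases e3 : ρ 1 = ρ 2 <;>
    simp_all [Finset.filter_insert, Finset.filter_singleton, Finset.card_insert_of_notMem]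

/-- Isolation of a given leaf fixes its color and the center's and leaves two vertices free: 4
choices for each of 3 leaves. -/
theorem sum_isolated (x : Fin 1 ⊕ Fin 3 → Fin 2) :
    ∑ y : Fin 1 ⊕ Fin 3 → Fin 2,
      ({v | y v ≠ y (.inl 0) ∧ x v ≠ y v} : Finset (Fin 1 ⊕ Fin 3)).card = 12 := by
  revert x
  decide +kernel

theorem sum_center (x : Fin 1 ⊕ Fin 3 → Fin 2) :
    ∑ y : Fin 1 ⊕ Fin 3 → Fin 2, (if x (.inl 0) = y (.inl 0) then (1 : ℤ) else 0) = 8 := by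
  revert x
  decide +kernel

/-- With two colors the condition forces `y` at the center and at leaf `i`, consistently only if `x`
separates them; the other two leaves are free. -/
theorem sum_leaf (x : Fin 1 ⊕ Fin 3 → Fin 2) (i : Fin 3) :
    ∑ y : Fin 1 ⊕ Fin 3 → Fin 2, (if x (.inl 0) ≠ y (.inl 0) ∧ x (.inr i) = y (.inr i) ∧
      y (.inr i) = y (.inl 0) then (1 : ℤ) else 0)
      = if x (.inr i) ≠ x (.inl 0) then 4 else 0 := by
  revert x i
  decide +kernel

theorem sum_leaf_pair (x : Fin 1 ⊕ Fin 3 → Fin 2) {i j : Fin 3} (hij : i ≠ j)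
    (h : x (.inr i) = x (.inr j)) :
    ∑ y : Fin 1 ⊕ Fin 3 → Fin 2, (if x (.inl 0) ≠ y (.inl 0) ∧
      (x (.inr i) = y (.inr i) ∧ y (.inr i) = y (.inl 0)) ∧
      (x (.inr j) = y (.inr j) ∧ y (.inr j) = y (.inl 0)) then (1 : ℤ) else 0)
      = if x (.inr i) ≠ x (.inl 0) then 2 else 0 := by
  revert x i j
  decide +kernel

theorem sum_leaf_triple (x : Fin 1 ⊕ Fin 3 → Fin 2) (h : x (.inr 0) = x (.inr 1))
    (h' : x (.inr 0) = x (.inr 2)) :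
    ∑ y : Fin 1 ⊕ Fin 3 → Fin 2, (if x (.inl 0) ≠ y (.inl 0) ∧
      (x (.inr 0) = y (.inr 0) ∧ y (.inr 0) = y (.inl 0)) ∧
      (x (.inr 1) = y (.inr 1) ∧ y (.inr 1) = y (.inl 0)) ∧
      (x (.inr 2) = y (.inr 2) ∧ y (.inr 2) = y (.inl 0)) then (1 : ℤ) else 0)
      = if x (.inr 0) ≠ x (.inl 0) then 1 else 0 := by
  revert x
  decide +kernel

/-- Both leaves and the center are forced; only the third leaf is free. -/
theorem sum_pair_persists (x : Fin 1 ⊕ Fin 3 → Fin 2) {i j : Fin 3} (hij : i ≠ j)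
    (h : x (.inr i) = x (.inr j)) :
    ∑ y : Fin 1 ⊕ Fin 3 → Fin 2, (if y (.inr i) ≠ y (.inl 0) ∧ y (.inr i) = x (.inr i) ∧
      y (.inr j) = x (.inr j) then (1 : ℤ) else 0) = 2 := by
  revert x i j
  decide +kernel

theorem sum_triple_persists (x : Fin 1 ⊕ Fin 3 → Fin 2) (h : x (.inr 0) = x (.inr 1))
    (h' : x (.inr 0) = x (.inr 2)) :
    ∑ y : Fin 1 ⊕ Fin 3 → Fin 2, (if y (.inr 0) ≠ y (.inl 0) ∧ y (.inr 0) = x (.inr 0) ∧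
      y (.inr 1) = x (.inr 1) ∧ y (.inr 2) = x (.inr 2) then (1 : ℤ) else 0) = 1 := by
  revert x
  decide +kernel

theorem sum_first_layer {n : ℕ} (F : (Fin 1 ⊕ Fin 3 → Fin 2) → ℤ) :
    ∑ c : (Fin 1 ⊕ Fin 3) × Fin (n + 1) → Fin 2, F (fun v => c (v, 0)) = 16 ^ n * ∑ y, F y := by
  rw [sum_consLayer]
  simp only [consLayer_zero, Finset.sum_const, Finset.card_univ, nsmul_eq_mul]
  congr 1
  simp [pow_mul]

/-! ### Joined leaves and the number of absorbed blocks. -/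

/-- Two leaves of the first layer lie in a common block. -/
def LeavesJoined {n : ℕ} (c : (Fin 1 ⊕ Fin 3) × Fin (n + 1) → Fin 2) (i j : Fin 3) : Prop :=
  (monoGraph (starPath (n + 1)) c).Reachable (.inr i, 0) (.inr j, 0)

theorem LeavesJoined.color_eq {n : ℕ} {c : (Fin 1 ⊕ Fin 3) × Fin (n + 1) → Fin 2} {i j : Fin 3}
    (h : LeavesJoined c i j) : c (.inr i, 0) = c (.inr j, 0) :=
  monoGraph_reachable_color h

theorem reachable_center_of_color_eq {n : ℕ} {c : (Fin 1 ⊕ Fin 3) × Fin (n + 1) → Fin 2}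
    {v : Fin 1 ⊕ Fin 3} (h : c (v, 0) = c (.inl 0, 0)) :
    (monoGraph (starPath (n + 1)) c).Reachable (v, 0) (.inl 0, 0) := by
  rcases v with v | v
  · rw [Fin.fin_one_eq_zero v]
  · refine Adj.reachable ⟨?_, h⟩
    simp [boxProd_adj]

theorem leavesJoined_of_color_eq {n : ℕ} {c : (Fin 1 ⊕ Fin 3) × Fin (n + 1) → Fin 2} {i j : Fin 3}
    (hi : c (.inr i, 0) = c (.inl 0, 0)) (hj : c (.inr j, 0) = c (.inl 0, 0)) :
    LeavesJoined c i j :=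
  (reachable_center_of_color_eq hi).trans (reachable_center_of_color_eq hj).symm

open Classical in
theorem ncard_touched {n : ℕ} (y : Fin 1 ⊕ Fin 3 → Fin 2)
    (c : (Fin 1 ⊕ Fin 3) × Fin (n + 1) → Fin 2) (p : Fin 3 → Prop) [DecidablePred p]
    (hp : ∀ i, p i ↔ c (.inr i, 0) = y (.inr i) ∧ y (.inr i) = y (.inl 0)) (q : Prop) [Decidable q]
    (hq : q ↔ c (.inl 0, 0) ≠ y (.inl 0)) :
    ({a | Touched y c a}.ncard : ℤ)
      = (if c (.inl 0, 0) = y (.inl 0) then 1 else 0)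
        + (if q ∧ p 0 then 1 else 0) + (if q ∧ p 1 then 1 else 0) + (if q ∧ p 2 then 1 else 0)
        - (if LeavesJoined c 0 1 then if q ∧ p 0 ∧ p 1 then 1 else 0 else 0)
        - (if LeavesJoined c 0 2 then if q ∧ p 0 ∧ p 2 then 1 else 0 else 0)
        - (if LeavesJoined c 1 2 then if q ∧ p 1 ∧ p 2 then 1 else 0 else 0)
        + (if LeavesJoined c 0 1 ∧ LeavesJoined c 0 2 then
            if q ∧ p 0 ∧ p 1 ∧ p 2 then 1 else 0 else 0) := by
  -- When the centers agree, every contact vertex has the old center's color, hence lies in the old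
  -- center's block.
  by_cases h0 : c (.inl 0, 0) = y (.inl 0)
  · have hq' : ¬ q := by simp [hq, h0]
    have : {a | Touched y c a} = {connectedComponentMk _ (.inl 0, 0)} := by
      ext a
      constructor
      · rintro ⟨v, hv, hv', rfl⟩
        exact ConnectedComponent.eq.2 (reachable_center_of_color_eq (by rw [hv, hv', h0]))
      · rintro rfl
        exact ⟨.inl 0, h0, rfl, rfl⟩
    rw [this]
    simp [h0, hq']
  · have hq' : q := hq.2 h0
    have : {a | Touched y c a} = (fun i : Fin 3 => connectedComponentMk
        (monoGraph (starPath (n + 1)) c) (.inr i, 0)) '' {i | p i} := by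
      ext a
      constructor
      · rintro ⟨v | v, hv, hv', rfl⟩
        · rw [Fin.fin_one_eq_zero v] at hv
          exact absurd hv h0
        · exact ⟨v, (hp v).2 ⟨hv, hv'⟩, rfl⟩
      · rintro ⟨i, hi, rfl⟩
        exact ⟨_, ((hp i).1 hi).1, ((hp i).1 hi).2, rfl⟩
    rw [this, ncard_image_fin_three]
    simp only [ConnectedComponent.eq, LeavesJoined, hq', h0, true_and, if_false, zero_add,
      ← ite_and]
    congr 1
    · congr 1
      · congr 1
        · congr 1
          exact if_congr (by tauto) rfl rfl
        · exact if_congr (by tauto) rfl rfl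
      · exact if_congr (by tauto) rfl rfl
    · exact if_congr (by tauto) rfl rfl

/-! ### Totals over all colorings and their recurrences. -/

open Classical in
/-- The number of colorings in which two leaves of the first layer lie in a common block that does
not contain the center. -/
noncomputable def pairTotal (n : ℕ) (i j : Fin 3) : ℤ :=
  ∑ c : (Fin 1 ⊕ Fin 3) × Fin (n + 1) → Fin 2,
    if c (.inr i, 0) ≠ c (.inl 0, 0) ∧ LeavesJoined c i j then 1 else 0

open Classical in
/-- The number of colorings in which the leaves of the first layer lie in a common block that does
not contain the center. -/
noncomputable def tripleTotal (n : ℕ) : ℤ :=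
  ∑ c : (Fin 1 ⊕ Fin 3) × Fin (n + 1) → Fin 2,
    if c (.inr 0, 0) ≠ c (.inl 0, 0) ∧ LeavesJoined c 0 1 ∧ LeavesJoined c 0 2 then 1 else 0

/-- The total number of blocks over all colorings. -/
noncomputable def blockTotal (n : ℕ) : ℤ :=
  ∑ c : (Fin 1 ⊕ Fin 3) × Fin n → Fin 2, ((partitionOfColoring (starPath n) c).size : ℤ)

open Classical in
theorem sum_touched {n : ℕ} (c : (Fin 1 ⊕ Fin 3) × Fin (n + 1) → Fin 2) :
    ∑ y : Fin 1 ⊕ Fin 3 → Fin 2, ({a | Touched y c a}.ncard : ℤ)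
      = 8 + (if c (.inr 0, 0) ≠ c (.inl 0, 0) then 4 else 0)
        + (if c (.inr 1, 0) ≠ c (.inl 0, 0) then 4 else 0)
        + (if c (.inr 2, 0) ≠ c (.inl 0, 0) then 4 else 0)
        - 2 * (if c (.inr 0, 0) ≠ c (.inl 0, 0) ∧ LeavesJoined c 0 1 then 1 else 0)
        - 2 * (if c (.inr 0, 0) ≠ c (.inl 0, 0) ∧ LeavesJoined c 0 2 then 1 else 0)
        - 2 * (if c (.inr 1, 0) ≠ c (.inl 0, 0) ∧ LeavesJoined c 1 2 then 1 else 0)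
        + (if c (.inr 0, 0) ≠ c (.inl 0, 0) ∧ LeavesJoined c 0 1 ∧ LeavesJoined c 0 2
            then 1 else 0) := by
  have hpair : ∀ i j : Fin 3, i ≠ j →
      (∑ y : Fin 1 ⊕ Fin 3 → Fin 2, if LeavesJoined c i j then
        if c (.inl 0, 0) ≠ y (.inl 0) ∧ (c (.inr i, 0) = y (.inr i) ∧ y (.inr i) = y (.inl 0)) ∧
          (c (.inr j, 0) = y (.inr j) ∧ y (.inr j) = y (.inl 0)) then (1 : ℤ) else 0 else 0)
      = 2 * (if c (.inr i, 0) ≠ c (.inl 0, 0) ∧ LeavesJoined c i j then 1 else 0) := by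
    intro i j hij
    by_cases h : LeavesJoined c i j
    · simp only [h, if_true, and_true]
      rw [sum_leaf_pair (fun v => c (v, 0)) hij h.color_eq]
      split_ifs <;> rfl
    · simp [h]
  have htriple : (∑ y : Fin 1 ⊕ Fin 3 → Fin 2, if LeavesJoined c 0 1 ∧ LeavesJoined c 0 2 then
        if c (.inl 0, 0) ≠ y (.inl 0) ∧ (c (.inr 0, 0) = y (.inr 0) ∧ y (.inr 0) = y (.inl 0)) ∧
          (c (.inr 1, 0) = y (.inr 1) ∧ y (.inr 1) = y (.inl 0)) ∧
          (c (.inr 2, 0) = y (.inr 2) ∧ y (.inr 2) = y (.inl 0)) then (1 : ℤ) else 0 else 0)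
      = if c (.inr 0, 0) ≠ c (.inl 0, 0) ∧ LeavesJoined c 0 1 ∧ LeavesJoined c 0 2
          then 1 else 0 := by
    by_cases h : LeavesJoined c 0 1 ∧ LeavesJoined c 0 2
    · simp only [h, if_true, and_true]
      exact sum_leaf_triple (fun v => c (v, 0)) h.1.color_eq h.2.color_eq
    · simp only [h, if_false, and_false, Finset.sum_const_zero]
  rw [Finset.sum_congr rfl fun y _ => ncard_touched y c
    (fun i => c (.inr i, 0) = y (.inr i) ∧ y (.inr i) = y (.inl 0)) (fun _ => Iff.rfl)
    (c (.inl 0, 0) ≠ y (.inl 0)) Iff.rfl]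
  simp only [Finset.sum_add_distrib, Finset.sum_sub_distrib]
  rw [hpair 0 1 (by decide), hpair 0 2 (by decide), hpair 1 2 (by decide), htriple,
    sum_center (fun v => c (v, 0)), sum_leaf (fun v => c (v, 0)) 0,
    sum_leaf (fun v => c (v, 0)) 1, sum_leaf (fun v => c (v, 0)) 2]

/-- For each `c`, the 16 new layers contribute `28 = 16 + 12` from center blocks and isolated
leaves, less the sum in `sum_touched`. The constant is `224 = 16 * (28 - 8) - 3 * 32`. -/
theorem blockTotal_succ (n : ℕ) :
    blockTotal (n + 2) = 16 * blockTotal (n + 1) + 224 * 16 ^ n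
      + 2 * pairTotal n 0 1 + 2 * pairTotal n 0 2 + 2 * pairTotal n 1 2 - tripleTotal n := by
  classical
  have hstep : ∀ (c : (Fin 1 ⊕ Fin 3) × Fin (n + 1) → Fin 2),
      ∑ y : Fin 1 ⊕ Fin 3 → Fin 2,
        ((partitionOfColoring (starPath (n + 2)) (consLayer y c)).size : ℤ)
      = 16 * ((partitionOfColoring (starPath (n + 1)) c).size : ℤ) + 28
        - ∑ y : Fin 1 ⊕ Fin 3 → Fin 2, ({a | Touched y c a}.ncard : ℤ) := by
    intro c
    have h1 : ∀ y : Fin 1 ⊕ Fin 3 → Fin 2,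
        ((partitionOfColoring (starPath (n + 2)) (consLayer y c)).size : ℤ)
        = ((partitionOfColoring (starPath (n + 1)) c).size : ℤ) + 1
          + (({v | y v ≠ y (.inl 0) ∧ c (v, 0) ≠ y v} : Finset (Fin 1 ⊕ Fin 3)).card : ℤ)
          - ({a | Touched y c a}.ncard : ℤ) := by
      intro y
      have := size_consLayer y c
      rw [Set.ncard_eq_toFinset_card' {v | y v ≠ y (.inl 0) ∧ c (v, 0) ≠ y v}] at this
      have h2 : {v | y v ≠ y (.inl 0) ∧ c (v, 0) ≠ y v}.toFinset
        = ({v | y v ≠ y (.inl 0) ∧ c (v, 0) ≠ y v} : Finset (Fin 1 ⊕ Fin 3)) := by ext; simp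
      rw [h2] at this
      zify at this
      linarith
    have h3 := sum_isolated (fun v => c (v, 0))
    zify at h3
    rw [Finset.sum_congr rfl fun y _ => h1 y]
    simp only [Finset.sum_add_distrib, Finset.sum_sub_distrib, Finset.sum_const, Finset.card_univ]
    rw [h3]
    simp
    ring
  have hleaf : ∀ i : Fin 3, ∑ c : (Fin 1 ⊕ Fin 3) × Fin (n + 1) → Fin 2,
      (if c (.inr i, 0) ≠ c (.inl 0, 0) then (4 : ℤ) else 0) = 32 * 16 ^ n := by
    intro i
    rw [sum_first_layer (fun x => if x (.inr i) ≠ x (.inl 0) then (4 : ℤ) else 0), mul_comm]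
    congr 1
    revert i
    decide +kernel
  have hcard : ∀ k : ℤ, ∑ _c : (Fin 1 ⊕ Fin 3) × Fin (n + 1) → Fin 2, k = k * (16 * 16 ^ n) := by
    intro k
    rw [sum_first_layer (fun _ => k)]
    simp
    ring
  rw [blockTotal, sum_consLayer, Finset.sum_congr rfl fun c _ => hstep c]
  simp only [sum_touched, Finset.sum_add_distrib, Finset.sum_sub_distrib, ← Finset.mul_sum, hcard,
    hleaf]
  simp only [blockTotal, pairTotal, tripleTotal]
  ring

/-- A joined pair survives away from the center for 2 of the 16 new layers, whether or not its old
block contained the old center. If it did, being joined is automatic and only the center's color and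
the third leaf vary, so the source term is `2 * 4 * 16 ^ n`. -/
theorem pairTotal_succ (n : ℕ) {i j : Fin 3} (hij : i ≠ j) :
    pairTotal (n + 1) i j = 2 * pairTotal n i j + 8 * 16 ^ n := by
  classical
  have hstep : ∀ c : (Fin 1 ⊕ Fin 3) × Fin (n + 1) → Fin 2,
      ∑ y : Fin 1 ⊕ Fin 3 → Fin 2, (if consLayer y c (.inr i, 0) ≠ consLayer y c (.inl 0, 0) ∧
        LeavesJoined (consLayer y c) i j then (1 : ℤ) else 0)
      = 2 * (if c (.inr i, 0) ≠ c (.inl 0, 0) ∧ LeavesJoined c i j then 1 else 0)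
        + (if c (.inr i, 0) = c (.inl 0, 0) ∧ c (.inr j, 0) = c (.inl 0, 0) then 2 else 0) := by
    intro c
    simp only [consLayer_zero, LeavesJoined, reachable_consLayer_leaves _ _ hij]
    by_cases h : LeavesJoined c i j
    · have h' := sum_pair_persists (fun v => c (v, 0)) hij h.color_eq
      have hc := h.color_eq
      rw [LeavesJoined] at h
      simp only [h, and_true, ← hc]
      split_ifs <;> simp_all
    -- Unjoined leaves cannot both have the center's color, so both sides vanish.
    · have h' : ¬ (c (.inr i, 0) = c (.inl 0, 0) ∧ c (.inr j, 0) = c (.inl 0, 0)) :=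
        fun hh => h (leavesJoined_of_color_eq hh.1 hh.2)
      rw [LeavesJoined] at h
      simp [h, h']
  rw [pairTotal, sum_consLayer, Finset.sum_congr rfl fun c _ => hstep c, Finset.sum_add_distrib,
    ← Finset.mul_sum, ← pairTotal, sum_first_layer (fun x =>
      if x (.inr i) = x (.inl 0) ∧ x (.inr j) = x (.inl 0) then (2 : ℤ) else 0), mul_comm (16 ^ n)]
  congr 2
  clear hstep
  revert i j
  decide +kernel

theorem tripleTotal_succ (n : ℕ) : tripleTotal (n + 1) = tripleTotal n + 2 * 16 ^ n := by
  classical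
  have hstep : ∀ c : (Fin 1 ⊕ Fin 3) × Fin (n + 1) → Fin 2,
      ∑ y : Fin 1 ⊕ Fin 3 → Fin 2, (if consLayer y c (.inr 0, 0) ≠ consLayer y c (.inl 0, 0) ∧
        LeavesJoined (consLayer y c) 0 1 ∧ LeavesJoined (consLayer y c) 0 2 then (1 : ℤ) else 0)
      = (if c (.inr 0, 0) ≠ c (.inl 0, 0) ∧ LeavesJoined c 0 1 ∧ LeavesJoined c 0 2 then 1 else 0)
        + (if c (.inr 0, 0) = c (.inl 0, 0) ∧ c (.inr 1, 0) = c (.inl 0, 0) ∧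
            c (.inr 2, 0) = c (.inl 0, 0) then 1 else 0) := by
    intro c
    have hiff : ∀ y : Fin 1 ⊕ Fin 3 → Fin 2, (y (.inr 0) ≠ y (.inl 0) ∧
        LeavesJoined (consLayer y c) 0 1 ∧ LeavesJoined (consLayer y c) 0 2) ↔
        (y (.inr 0) ≠ y (.inl 0) ∧ y (.inr 0) = c (.inr 0, 0) ∧
          y (.inr 1) = c (.inr 1, 0) ∧ y (.inr 2) = c (.inr 2, 0)) ∧
          (LeavesJoined c 0 1 ∧ LeavesJoined c 0 2) := by
      intro y
      have h1 := reachable_consLayer_leaves y c (i := 0) (j := 1) (by decide)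
      have h2 := reachable_consLayer_leaves y c (i := 0) (j := 2) (by decide)
      simp only [LeavesJoined]
      tauto
    simp only [consLayer_zero, hiff]
    by_cases h : LeavesJoined c 0 1 ∧ LeavesJoined c 0 2
    · have h' := sum_triple_persists (fun v => c (v, 0)) h.1.color_eq h.2.color_eq
      have hc := h.1.color_eq
      have hc' := h.2.color_eq
      simp only [h, and_true, ← hc, ← hc']
      split_ifs <;> simp_all
    · have h' : ¬ (c (.inr 0, 0) = c (.inl 0, 0) ∧ c (.inr 1, 0) = c (.inl 0, 0) ∧
            c (.inr 2, 0) = c (.inl 0, 0)) :=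
        fun hh => h ⟨leavesJoined_of_color_eq hh.1 hh.2.1, leavesJoined_of_color_eq hh.1 hh.2.2⟩
      simp only [h, h', and_false, if_false, Finset.sum_const_zero, add_zero]
  rw [tripleTotal, sum_consLayer, Finset.sum_congr rfl fun c _ => hstep c, Finset.sum_add_distrib,
    ← tripleTotal, sum_first_layer (fun x => if x (.inr 0) = x (.inl 0) ∧
      x (.inr 1) = x (.inl 0) ∧ x (.inr 2) = x (.inl 0) then (1 : ℤ) else 0), mul_comm (16 ^ n)]
  congr 2

/-! ### Initial values from a single star. -/

/-- A function whose fibers are the blocks of a coloring of a single layer. -/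
def starLabel (c : (Fin 1 ⊕ Fin 3) × Fin 1 → Fin 2) (p : (Fin 1 ⊕ Fin 3) × Fin 1) :
    Option (Fin 1 ⊕ Fin 3) :=
  if c (p.1, 0) = c (.inl 0, 0) then none else some p.1

theorem reachable_star_iff (c : (Fin 1 ⊕ Fin 3) × Fin 1 → Fin 2)
    (p q : (Fin 1 ⊕ Fin 3) × Fin 1) :
    (monoGraph (starPath 1) c).Reachable p q ↔ starLabel c p = starLabel c q := by
  constructor
  · rintro ⟨w⟩
    induction w with
    | nil => rfl
    | @cons a b _ h _ ih =>
      refine Eq.trans ?_ ih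
      obtain ⟨v, k⟩ := a
      obtain ⟨w, l⟩ := b
      obtain rfl := Fin.fin_one_eq_zero k
      obtain rfl := Fin.fin_one_eq_zero l
      obtain ⟨h, h'⟩ := h
      have hvw : (completeBipartiteGraph (Fin 1) (Fin 3)).Adj v w := by
        simpa only [boxProd_adj, SimpleGraph.irrefl, false_and, and_true, or_false] using h
      rcases eq_center_of_adj hvw with rfl | rfl <;> simp [starLabel, h']
  · obtain ⟨v, k⟩ := p
    obtain ⟨w, l⟩ := q
    obtain rfl := Fin.fin_one_eq_zero k
    obtain rfl := Fin.fin_one_eq_zero l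
    intro h
    simp only [starLabel] at h
    split_ifs at h with h1 h2 h2
    · exact (reachable_center_of_color_eq h1).trans (reachable_center_of_color_eq h2).symm
    · simp only [Option.some.injEq] at h
      rw [h]

theorem pairTotal_zero {i j : Fin 3} (hij : i ≠ j) : pairTotal 0 i j = 0 := by
  classical
  refine Finset.sum_eq_zero fun c _ => if_neg ?_
  rintro ⟨h, h'⟩
  rw [LeavesJoined, reachable_star_iff, starLabel, if_neg h, starLabel] at h'
  split_ifs at h'
  simp [hij] at h'

theorem tripleTotal_zero : tripleTotal 0 = 0 := by
  classical
  refine Finset.sum_eq_zero fun c _ => if_neg ?_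
  rintro ⟨h, h', -⟩
  rw [LeavesJoined, reachable_star_iff, starLabel, if_neg h, starLabel] at h'
  split_ifs at h'
  simp at h'

theorem blockTotal_one : blockTotal 1 = 40 := by
  have hsize : ∀ c : (Fin 1 ⊕ Fin 3) × Fin 1 → Fin 2,
      ((partitionOfColoring (starPath 1) c).size : ℤ) =
      ((Finset.univ.image fun v => starLabel c (v, 0)).card : ℤ) := by
    intro c
    rw [size_partitionOfColoring_eq_ncard_range _ _ _ (reachable_star_iff c),
      ← Set.ncard_coe_finset]
    congr 2
    ext l
    constructor
    · rintro ⟨p, rfl⟩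
      exact Finset.mem_coe.2 (Finset.mem_image.2 ⟨p.1, Finset.mem_univ _, rfl⟩)
    · intro h
      obtain ⟨v, -, rfl⟩ := Finset.mem_image.1 (Finset.mem_coe.1 h)
      exact ⟨_, rfl⟩
  rw [blockTotal, Finset.sum_congr rfl fun c _ => hsize c]
  have := sum_first_layer (n := 0) fun x : Fin 1 ⊕ Fin 3 → Fin 2 =>
    ((Finset.univ.image fun v => if x v = x (.inl 0) then none else some v).card : ℤ)
  refine this.trans ?_
  decide +kernel

/-! ### Solving the recurrences. -/

theorem seven_mul_pairTotal (n : ℕ) {i j : Fin 3} (hij : i ≠ j) :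
    7 * pairTotal n i j = 4 * 16 ^ n - 4 * 2 ^ n := by
  induction n with
  | zero => simp [pairTotal_zero hij]
  | succ n ih => rw [pairTotal_succ n hij, pow_succ, pow_succ]; linarith

theorem fifteen_mul_tripleTotal (n : ℕ) : 15 * tripleTotal n = 2 * (16 ^ n - 1) := by
  induction n with
  | zero => simp [tripleTotal_zero]
  | succ n ih => rw [tripleTotal_succ n, pow_succ]; linarith

theorem blockTotal_eq (n : ℕ) :
    (blockTotal (n + 1) : ℝ) = 16 ^ (n + 1) * (2254219 / 1411200 + 11933 / 13440 * ((n : ℝ) + 1))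
      + 6 / 49 * 2 ^ (n + 1) - 2 / 225 := by
  induction n with
  | zero => rw [blockTotal_one]; norm_num
  | succ n ih =>
    have h01 : 7 * (pairTotal n 0 1 : ℝ) = 4 * 16 ^ n - 4 * 2 ^ n :=
      mod_cast seven_mul_pairTotal n (i := 0) (j := 1) (by decide)
    have h02 : 7 * (pairTotal n 0 2 : ℝ) = 4 * 16 ^ n - 4 * 2 ^ n :=
      mod_cast seven_mul_pairTotal n (i := 0) (j := 2) (by decide)
    have h12 : 7 * (pairTotal n 1 2 : ℝ) = 4 * 16 ^ n - 4 * 2 ^ n :=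
      mod_cast seven_mul_pairTotal n (i := 1) (j := 2) (by decide)
    have ht : 15 * (tripleTotal n : ℝ) = 2 * (16 ^ n - 1) := mod_cast fifteen_mul_tripleTotal n
    rw [blockTotal_succ]
    push_cast
    rw [ih]
    ring_nf at h01 h02 h12 ht ⊢
    linarith

theorem blockTotal_div (n : ℕ) (hn : 1 ≤ n) :
    (blockTotal n : ℝ) / 16 ^ n = 2254219 / 1411200 + 6 / 49 * (2 : ℝ) ^ (-(3 * (n : ℤ)))
        - 2 / 225 * (2 : ℝ) ^ (-(4 * (n : ℤ))) + 11933 / 13440 * (n : ℝ) := by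
  obtain ⟨m, rfl⟩ := Nat.exists_eq_add_of_le' hn
  have h3 : (2 : ℝ) ^ (-(3 * ((m + 1 : ℕ) : ℤ))) = 2 ^ (m + 1) / 16 ^ (m + 1) := by
    rw [zpow_neg, zpow_mul, zpow_natCast, ← div_pow, ← inv_pow]
    norm_num
  have h4 : (2 : ℝ) ^ (-(4 * ((m + 1 : ℕ) : ℤ))) = 1 / 16 ^ (m + 1) := by
    rw [zpow_neg, zpow_mul, zpow_natCast, one_div]
    norm_num
  rw [h3, h4, blockTotal_eq]
  have : (16 : ℝ) ^ (m + 1) ≠ 0 := by positivity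
  field_simp
  push_cast
  ring

/-! ### From totals to expectations. -/

/-- A colored partition is determined by its coloring, which is arbitrary. -/
noncomputable def partitionOfColoringEquiv {V : Type*} (G : SimpleGraph V) (k : ℕ) :
    (V → Fin k) ≃ ColoredPartition G k where
  toFun := partitionOfColoring G
  invFun T := T.color
  left_inv c := partitionOfColoring_color G c
  right_inv T := (existsUnique_coloredPartition G T.color).unique
    (partitionOfColoring_color G T.color) rfl

theorem uniformOn_univ_real_singleton {Ω : Type*} [Fintype Ω] [MeasurableSpace Ω]
    [MeasurableSingletonClass Ω] (ω : Ω) :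
    (uniformOn (Set.univ : Set Ω)).real {ω} = 1 / Fintype.card Ω := by
  rw [measureReal_def, uniformOn_univ]
  simp

theorem integral_coloringLaw {V : Type*} [Fintype V] [DecidableEq V] (k : ℕ) [NeZero k]
    (F : (V → Fin k) → ℝ) :
    ∫ c, F c ∂coloringLaw V k = (∑ c, F c) / k ^ Fintype.card V := by
  have : IsProbabilityMeasure (uniformOn (Set.univ : Set (Fin k))) :=
    isProbabilityMeasure_uniformOn Set.finite_univ Set.univ_nonempty
  rw [coloringLaw, integral_fintype Integrable.of_finite, Finset.sum_div]
  refine Finset.sum_congr rfl fun c _ => ?_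
  rw [measureReal_def, Measure.pi_singleton, ENNReal.toReal_prod]
  simp only [← measureReal_def, uniformOn_univ_real_singleton]
  simp
  ring

/-- The bijection with colorings carries the uniform law to the uniform law, so both expectations
are the same average. -/
theorem integral_uniformOn_coloredPartition {V : Type*} [Fintype V] [DecidableEq V]
    (G : SimpleGraph V) (k : ℕ) (F : ColoredPartition G k → ℝ) :
    ∫ T, F T ∂uniformOn (Set.univ : Set (ColoredPartition G k))
      = (∑ c, F (partitionOfColoring G c)) / k ^ Fintype.card V := by
  let _ : Fintype (ColoredPartition G k) := Fintype.ofEquiv _ (partitionOfColoringEquiv G k)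
  have _ : MeasurableSingletonClass (ColoredPartition G k) := ⟨fun _ => trivial⟩
  have _ : IsFiniteMeasure (uniformOn (Set.univ : Set (ColoredPartition G k))) := by
    unfold uniformOn; infer_instance
  rw [integral_fintype Integrable.of_finite, Finset.sum_div,
    ← (partitionOfColoringEquiv G k).sum_comp]
  refine Finset.sum_congr rfl fun c _ => ?_
  rw [uniformOn_univ_real_singleton, ← Fintype.card_congr (partitionOfColoringEquiv G k)]
  simp only [partitionOfColoringEquiv, Equiv.coe_fn_mk, smul_eq_mul, Fintype.card_fun,
    Fintype.card_fin, Nat.cast_pow]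
  ring

end BlockColoring

/-- The expected number of blocks of `K_{1,3} × P_n`: first when the vertices are colored uniformly
and independently with two colors, then for a uniformly random `2`-colored partition. -/
theorem mainTheorem12 (n : ℕ) (hn : 1 ≤ n) :
    ∫ c, ((BlockColoring.partitionOfColoring (BlockColoring.starPath n) c).size : ℝ)
        ∂(BlockColoring.coloringLaw ((Fin 1 ⊕ Fin 3) × Fin n) 2)
      = 2254219 / 1411200 + 6 / 49 * (2 : ℝ) ^ (-(3 * (n : ℤ)))
        - 2 / 225 * (2 : ℝ) ^ (-(4 * (n : ℤ))) + 11933 / 13440 * (n : ℝ) ∧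
    ∫ T, (T.size : ℝ)
        ∂(uniformOn (Set.univ : Set (BlockColoring.ColoredPartition (BlockColoring.starPath n) 2)))
      = 2254219 / 1411200 + 6 / 49 * (2 : ℝ) ^ (-(3 * (n : ℤ)))
        - 2 / 225 * (2 : ℝ) ^ (-(4 * (n : ℤ))) + 11933 / 13440 * (n : ℝ) := by
  have hcard : ((2 : ℕ) : ℝ) ^ Fintype.card ((Fin 1 ⊕ Fin 3) × Fin n) = 16 ^ n := by
    simp [pow_mul]
    norm_num
  rw [BlockColoring.integral_coloringLaw, BlockColoring.integral_uniformOn_coloredPartition,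
    hcard, ← BlockColoring.blockTotal_div n hn, BlockColoring.blockTotal]
  push_cast
  exact ⟨rfl, rfl⟩
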